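/- **Setting.** Let $X$ be a finite or countably infinite set, and let $\alpha=(\alpha_{xy})_{x,y\in X}$ be a matrix with entries in $[0,\infty)$. No further hypothesis on $\alpha$ is made. All matrices below have entries in $[0,+\infty]$, with $0\cdot\infty=0$ and $A^0=I$. For $f\colon X\to[0,\infty)$ let $I_f$ be the diagonal matrix with entries $f(x)$. For $\Lambda\subseteq X$ put $I_\Lambda=I_{\chi_\Lambda}$, where $\chi_\Lambda$ is the indicator function of $\Lambda$. For $f\colon X\to[0,1]$ put $\beta_f=I_{1-f}+I_f\alpha$ and $\operatorname{supp} f=\{x: f(x)\neq 0\}$. For nonnegative vectors $c,w$ put $cAw=\sum_{x,y}c_xA_{xy}w_y\in[0,+\infty]$. A *marker* is a nonempty finite sequence $\eta=(x_0,\dots,x_k)$ in $X$; its *level* is $k$, and its *ancestors* are the markers $(x_0,\dots,x_j)$ with $0\le j\le k$ (written $\sigma\preccurlyeq\eta$). A *cloud* is a function $\nu$ from markers to $\mathbb R$. Put $$|||\nu|||=\sup_\eta\sum_{\sigma\preccurlyeq\eta}|\nu(\sigma)|,\qquad \widetilde\nu(\eta)=\sum_{\sigma\preccurlyeq\eta}\nu(\sigma).$$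 A cloud $\nu$ is *carried by* $\Lambda$ if $\nu(x_0,\dots,x_k)=0$ whenever $x_j\notin\Lambda$ for some $j<k$. It is *supported on finitely many levels* if, for some $N$, it vanishes on all markers of level $>N$. The class $\mathcal S_1$ consists of the clouds $\nu\ge0$ such that $\sup_{\eta'\colon\eta\preccurlyeq\eta'}\widetilde\nu(\eta')=1$ for every marker $\eta$. For a cloud $\nu\ge0$ put $$T_\nu=\sum_{\eta=(x_0,\dots,x_k)}\nu(\eta)\,I_{\{x_0\}}\alpha I_{\{x_1\}}\alpha\cdots\alpha I_{\{x_k\}}.$$ **Theorem.** Let $\Lambda\subseteq X$, and let $c\ge0$ and $w\ge0$ be real vectors indexed by $X$ that are strictly positive on $\Lambda$. Consider the following conditions. * (a) $\sum_{k=0}^\infty c(I_\Lambda\alpha I_\Lambda)^kw<\infty$. * (b) For all $h\colon X\to[0,1]$ with $\operatorname{supp}h=\Lambda$ such that $h\ge\epsilon\chi_\Lambda$ for some $\epsilon>0$, we have $\sum_{k=0}^\infty c(I_\Lambda\beta_hI_\Lambda)^kw<\infty$. * (b′) There exists $h\colon X\to[0,1]$ with $\operatorname{supp}h=\Lambda$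 such that $\sum_{k=0}^\infty c(I_\Lambda\beta_hI_\Lambda)^kw<\infty$. * (c) For every finite sequence $f_1,\dots,f_m$ of functions $X\to[0,1]$ with $\operatorname{supp}(f_i)\subseteq\Lambda$ such that $\sum_if_i\ge\epsilon\chi_\Lambda$ for some $\epsilon>0$, we have $\sum_{k=0}^\infty c(I_\Lambda\beta_{f_1}\cdots\beta_{f_m}I_\Lambda)^kw<\infty$. * (c′) There exists a finite sequence $f_1,\dots,f_m$ of functions $X\to[0,1]$ with $\operatorname{supp}(f_i)\subseteq\Lambda$ such that $\sum_{k=0}^\infty c(I_\Lambda\beta_{f_1}\cdots\beta_{f_m}I_\Lambda)^kw<\infty$. * (d) For every cloud $\nu\ge0$ that is carried by $\Lambda$ and satisfies $|||\nu|||\le1$ and, for some $\epsilon>0$, $\nu((x))\le1-\epsilon$ for every $x\in\Lambda$, we have $\sum_{k=0}^\infty c(I_\Lambda T_\nu I_\Lambda)^kw<\infty$. * (d′) There exists a cloud $\nu\in\mathcal S_1$ that is carried by $\Lambda$ and supported on finitely many levels, such that $\sum_{k=0}^\infty c(I_\Lambda T_\nu I_\Lambda)^kw<\infty$. Then (a),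 (b), (b′), (c) and (d) are equivalent; they imply (c′); and (c′) implies (d′). If, in addition, there exists a constant $C<\infty$ such that $I_\Lambda\alpha I_\Lambda w\le Cw$, then all seven conditions are equivalent. -/

import Mathlib

open scoped NNReal ENNReal

namespace Balayage

universe u

/-! ### Nonnegative matrices with entries in `[0, ∞]` -/

/-- Matrices `(A x y)` indexed by `X`, with entries in `[0, ∞]`
(entries of infinite matrix products may be infinite; `0 * ∞ = 0`). -/
def Op (X : Type u) : Type u := X → X → ℝ≥0∞

noncomputable section

variable {X : Type u}

@[ext] theorem Op.ext {A B : Op X} (h : ∀ x y, A x y = B x y) : A = B :=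
  funext fun x => funext fun y => h x y

/-- The operator `I_f` of multiplication by a nonnegative function `f`. -/
def mulOp (f : X → ℝ≥0∞) : Op X := fun x y => by
  classical exact if x = y then f x else 0

/-- The projection `I_Λ`. -/
def proj (Λ : Set X) : Op X := mulOp (Λ.indicator 1)

instance : Add (Op X) := ⟨fun A B x y => A x y + B x y⟩

/-- The (possibly infinite) matrix product. -/
instance : Mul (Op X) := ⟨fun A B x y => ∑' z, A x z * B z y⟩

/-- The identity matrix. -/
instance : One (Op X) := ⟨mulOp 1⟩

theorem Op.mul_apply (A B : Op X) (x y : X) : (A * B) x y = ∑' z, A x z * B z y := rfl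

theorem Op.one_apply (x y : X) : (1 : Op X) x y = mulOp 1 x y := rfl

theorem mulOp_mul_apply (f : X → ℝ≥0∞) (A : Op X) (x y : X) :
    (mulOp f * A) x y = f x * A x y := by
  rw [Op.mul_apply, tsum_eq_single x]
  · simp [mulOp]
  · intro z hz
    simp [mulOp, hz.symm]

theorem mul_mulOp_apply (f : X → ℝ≥0∞) (A : Op X) (x y : X) :
    (A * mulOp f) x y = A x y * f y := by
  rw [Op.mul_apply, tsum_eq_single y]
  · simp [mulOp]
  · intro z hz
    simp [mulOp, hz]

/-- Matrices over `[0, ∞]` form a monoid, so `A ^ k` (with `A ^ 0 = I`) and ordered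
products of lists are available. -/
instance : Monoid (Op X) where
  mul_assoc A B C := by
    ext x y
    simp only [Op.mul_apply, ← ENNReal.tsum_mul_left, ← ENNReal.tsum_mul_right]
    rw [ENNReal.tsum_comm]
    simp only [mul_assoc]
  one_mul A := by
    ext x y
    exact (mulOp_mul_apply 1 A x y).trans (one_mul _)
  mul_one A := by
    ext x y
    exact (mul_mulOp_apply 1 A x y).trans (mul_one _)

/-- A nonnegative real matrix, viewed as a matrix over `[0, ∞]`. -/
def toOp (α : X → X → ℝ≥0) : Op X := fun x y => (α x y : ℝ≥0∞)

/-- The cleaning operator `β_f = I_{1-f} + I_f α`, for `f : X → [0,1]`. -/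
def cleaner (α : X → X → ℝ≥0) (f : X → unitInterval) : Op X :=
  mulOp (fun x => ENNReal.ofReal (1 - (f x : ℝ))) +
    mulOp (fun x => ENNReal.ofReal (f x : ℝ)) * toOp α

/-- The product `c A w` of a row vector, a matrix and a column vector. -/
def sandwich (c : X → ℝ≥0) (A : Op X) (w : X → ℝ≥0) : ℝ≥0∞ :=
  ∑' x, ∑' y, (c x : ℝ≥0∞) * A x y * (w y : ℝ≥0∞)

/-- The sum `∑_{k ≥ 0} c (I_Λ A I_Λ)^k w`. -/
def geomSum (Λ : Set X) (c w : X → ℝ≥0) (A : Op X) : ℝ≥0∞ :=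
  ∑' k : ℕ, sandwich c ((proj Λ * A * proj Λ) ^ k) w

/-! ### Markers and clouds -/

/-- A marker: a nonempty finite sequence `(x₀, x₁, …, x_k)`, stored as its first entry `x₀`
and the list `[x₁, …, x_k]` of the remaining entries. -/
@[ext] structure Marker (X : Type u) : Type u where
  /-- the entry `x₀` -/
  first : X
  /-- the entries `x₁, …, x_k` -/
  rest : List X

/-- The level `k` of `(x₀, …, x_k)`. -/
def Marker.level (η : Marker X) : ℕ := η.rest.length

/-- The list of all entries. -/
def Marker.toList (η : Marker X) : List X := η.first :: η.rest

/-- The initial segment `(x₀, …, x_j)`, for `j ≤ η.level`. -/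
def Marker.take (η : Marker X) (j : ℕ) : Marker X := ⟨η.first, η.rest.take j⟩

/-- `σ` is an ancestor of `η`, i.e. one of its initial segments. -/
def Marker.IsAncestor (σ η : Marker X) : Prop := ∃ j ≤ η.level, σ = η.take j

/-- A cloud is a real-valued function on markers. -/
abbrev Cloud (X : Type u) : Type u := Marker X → ℝ

/-- The norm `sup_η ∑_{σ ancestor of η} |ν σ|`, in `[0, ∞]`. -/
def cloudNorm (ν : Cloud X) : ℝ≥0∞ :=
  ⨆ η : Marker X, ENNReal.ofReal (∑ j ∈ Finset.range (η.level + 1), |ν (η.take j)|)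

/-- The cumulative distribution `∑_{σ ancestor of η} ν σ`. -/
def cumul (ν : Cloud X) (η : Marker X) : ℝ :=
  ∑ j ∈ Finset.range (η.level + 1), ν (η.take j)

/-- For a nonnegative cloud `μ`, the supremum (in `[0, ∞]`) of its cumulative distribution
over all markers having `η` as an ancestor. -/
def branchSup (μ : Cloud X) (η : Marker X) : ℝ≥0∞ :=
  ⨆ (η' : Marker X) (_ : η.IsAncestor η'), ENNReal.ofReal (cumul μ η')

/-- The class `𝒮_a` of nonnegative clouds whose branch suprema are all equal to `a`. -/
def ClassS (a : ℝ≥0) : Set (Cloud X) :=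
  {μ | 0 ≤ μ ∧ ∀ η, branchSup μ η = (a : ℝ≥0∞)}

/-- `μ` is carried by `Λ`: it vanishes on each `(x₀, …, x_k)` that has some `x_j ∉ Λ`
with `j < k`. -/
def CarriedBy (Λ : Set X) (μ : Cloud X) : Prop :=
  ∀ η : Marker X, (∃ x ∈ η.toList.dropLast, x ∉ Λ) → μ η = 0

/-- `ν` vanishes on all markers of sufficiently high level. -/
def FinitelyManyLevels (ν : Cloud X) : Prop :=
  ∃ N : ℕ, ∀ η : Marker X, N < η.level → ν η = 0

/-- The matrix `I_{x₀} α I_{x₁} α ⋯ α I_{x_k}`. -/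
def pathOp (α : X → X → ℝ≥0) : X → List X → Op X
  | x, [] => proj {x}
  | x, y :: t => proj {x} * toOp α * pathOp α y t

/-- The matrix `T_ν = ∑_η ν_η T_η` of a nonnegative cloud `ν`, where
`T_{(x₀, …, x_k)} = I_{x₀} α I_{x₁} α ⋯ α I_{x_k}`. -/
def cloudOp (α : X → X → ℝ≥0) (ν : Cloud X) : Op X := fun x y =>
  ∑' η : Marker X, ENNReal.ofReal (ν η) * pathOp α η.first η.rest x y

/-! ### The seven conditions -/

/-- (a) -/
def CondA (Λ : Set X) (c w : X → ℝ≥0) (α : X → X → ℝ≥0) : Prop :=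
  geomSum Λ c w (toOp α) < ∞

/-- (b) -/
def CondB (Λ : Set X) (c w : X → ℝ≥0) (α : X → X → ℝ≥0) : Prop :=
  ∀ h : X → unitInterval, Function.support h = Λ →
    (∃ ε : ℝ, 0 < ε ∧ ∀ x, ε * Λ.indicator 1 x ≤ (h x : ℝ)) →
    geomSum Λ c w (cleaner α h) < ∞

/-- (b') -/
def CondB' (Λ : Set X) (c w : X → ℝ≥0) (α : X → X → ℝ≥0) : Prop :=
  ∃ h : X → unitInterval, Function.support h = Λ ∧ geomSum Λ c w (cleaner α h) < ∞

/-- (c); the product `β_{f_1} ⋯ β_{f_m}` is taken in this order. -/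
def CondC (Λ : Set X) (c w : X → ℝ≥0) (α : X → X → ℝ≥0) : Prop :=
  ∀ (m : ℕ) (f : Fin m → X → unitInterval), (∀ i, Function.support (f i) ⊆ Λ) →
    (∃ ε : ℝ, 0 < ε ∧ ∀ x, ε * Λ.indicator 1 x ≤ ∑ i, (f i x : ℝ)) →
    geomSum Λ c w (List.ofFn fun i => cleaner α (f i)).prod < ∞

/-- (c') -/
def CondC' (Λ : Set X) (c w : X → ℝ≥0) (α : X → X → ℝ≥0) : Prop :=
  ∃ (m : ℕ) (f : Fin m → X → unitInterval), (∀ i, Function.support (f i) ⊆ Λ) ∧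
    geomSum Λ c w (List.ofFn fun i => cleaner α (f i)).prod < ∞

/-- (d) -/
def CondD (Λ : Set X) (c w : X → ℝ≥0) (α : X → X → ℝ≥0) : Prop :=
  ∀ ν : Cloud X, 0 ≤ ν → CarriedBy Λ ν → cloudNorm ν ≤ 1 →
    (∃ ε : ℝ, 0 < ε ∧ ∀ x ∈ Λ, ν ⟨x, []⟩ ≤ 1 - ε) →
    geomSum Λ c w (cloudOp α ν) < ∞

/-- (d') -/
def CondD' (Λ : Set X) (c w : X → ℝ≥0) (α : X → X → ℝ≥0) : Prop :=
  ∃ ν : Cloud X, ν ∈ ClassS 1 ∧ CarriedBy Λ ν ∧ FinitelyManyLevels ν ∧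
    geomSum Λ c w (cloudOp α ν) < ∞

/-- There is a finite constant `C` with `I_Λ α I_Λ w ≤ C w`. -/
def BoundedOn (Λ : Set X) (w : X → ℝ≥0) (α : X → X → ℝ≥0) : Prop :=
  ∃ C : ℝ≥0, ∀ x, ∑' y, (proj Λ * toOp α * proj Λ) x y * (w y : ℝ≥0∞) ≤ C * w x

end

end Balayage

/-!
Write `A = I_Λ α I_Λ` and let `g = ∑ A ^ k w` be its potential, the least function with
`w + A g ≤ g`. Each condition asks whether `c` integrates the potential of some compression
`K = I_Λ M I_Λ`, so everything reduces to comparing potentials (`green`) pointwise, which is done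
by exhibiting supersolutions. Potentials may be infinite and are never subtracted, except in
(b′) ⇒ (a), where they are finite.

* Both (a) ⇒ (c) and (a) ⇒ (d) follow from `δ w + K g ≤ g` on `Λ` for some `δ > 0`
  (`geomSum_lt_top_of_deficit`). For products of cleaning operators the loss at `x` is at least
  `f_i x * w x` for each `i` (`act_prod_cleaner_le`). For clouds, `g` is superharmonic, so moving
  mass down the tree of markers does not increase its integral (`pathSum_le`), and the mass `≥ ε`
  that leaves the root picks up `w` on the way.
* (b′) ⇒ (a): since `c > 0` on `Λ`, the potential `u` of `I_Λ β_h I_Λ` is finite there, and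
  `u = w + (1 - h) u + h α u` can be solved to give `w + A u ≤ u`.
* (c′) ⇒ (d′): `β_{f_1} ⋯ β_{f_m}` equals `T_ν` for an explicit cloud `ν`
  (`exists_cloudOp_eq_prod`).
* (d′) ⇒ (a) when `A w ≤ C w`: along each branch the mass of `ν` reaches `1` by some level `N`, so
  each partial sum `s` of `g` satisfies `s ≤ ∑_{k < N} A ^ k w + K s ≤ D w + K s` (`le_pathSum`).
  As `s` is itself at most a multiple of `w`, iteration gives `s ≤ D ∑ K ^ k w`
  (`le_smul_green`).

The remaining implications are specializations.
-/

namespace Balayage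

noncomputable section

variable {X : Type*}

/-! ### Matrices acting on column vectors -/

/-- The matrix-vector product `A v`. -/
def act (A : Op X) (v : X → ℝ≥0∞) : X → ℝ≥0∞ := fun x => ∑' y, A x y * v y

theorem act_mul (A B : Op X) (v : X → ℝ≥0∞) : act (A * B) v = act A (act B v) := by
  ext x
  simp only [act, Op.mul_apply, ← ENNReal.tsum_mul_left, ← ENNReal.tsum_mul_right]
  rw [ENNReal.tsum_comm]
  simp only [mul_assoc]

theorem act_mulOp (f v : X → ℝ≥0∞) (x : X) : act (mulOp f) v x = f x * v x := by
  rw [act, tsum_eq_single x]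
  · simp [mulOp]
  · intro z hz
    simp [mulOp, hz.symm]

theorem act_one (v : X → ℝ≥0∞) : act 1 v = v := by
  ext x
  exact (act_mulOp 1 v x).trans (one_mul _)

theorem act_proj (Λ : Set X) (v : X → ℝ≥0∞) : act (proj Λ) v = Λ.indicator v := by
  ext x
  rw [proj, act_mulOp]
  by_cases hx : x ∈ Λ <;> simp [hx]

theorem act_add_left (A B : Op X) (v : X → ℝ≥0∞) : act (A + B) v = act A v + act B v := by
  ext x
  simp only [act, Pi.add_apply, ← ENNReal.tsum_add, ← add_mul]
  rfl

theorem act_add (A : Op X) (u v : X → ℝ≥0∞) : act A (u + v) = act A u + act A v := by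
  ext x
  simp only [act, Pi.add_apply, ← ENNReal.tsum_add, ← mul_add]

theorem act_smul (A : Op X) (a : ℝ≥0∞) (v : X → ℝ≥0∞) : act A (a • v) = a • act A v := by
  ext x
  simp only [act, Pi.smul_apply, smul_eq_mul, ← ENNReal.tsum_mul_left]
  exact tsum_congr fun y => by ring

theorem act_mono (A : Op X) {u v : X → ℝ≥0∞} (h : u ≤ v) : act A u ≤ act A v :=
  fun _ => ENNReal.tsum_le_tsum fun y => mul_le_mul_right (h y) _

theorem act_sum (A : Op X) (n : ℕ) (v : ℕ → X → ℝ≥0∞) :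
    act A (∑ k ∈ Finset.range n, v k) = ∑ k ∈ Finset.range n, act A (v k) := by
  induction n with
  | zero => ext x; simp [act]
  | succ n ih => rw [Finset.sum_range_succ, act_add, ih, Finset.sum_range_succ]

theorem ext_of_act {A B : Op X} (h : ∀ v, act A v = act B v) : A = B := by
  classical
  have key : ∀ (M : Op X) (x y : X), act M (Pi.single y 1) x = M x y := by
    intro M x y
    rw [act, tsum_eq_single y]
    · simp
    · intro z hz
      simp [hz]
  ext x y
  rw [← key A, ← key B, h]

theorem act_cleaner (α : X → X → ℝ≥0) (f : X → unitInterval) (v : X → ℝ≥0∞) (x : X) :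
    act (cleaner α f) v x =
      ENNReal.ofReal (1 - (f x : ℝ)) * v x + ENNReal.ofReal (f x : ℝ) * act (toOp α) v x := by
  rw [cleaner, act_add_left, act_mul, Pi.add_apply, act_mulOp, act_mulOp]

theorem act_compress (Λ : Set X) (M : Op X) (v : X → ℝ≥0∞) :
    act (proj Λ * M * proj Λ) v = Λ.indicator (act M (Λ.indicator v)) := by
  rw [act_mul, act_mul, act_proj, act_proj]

theorem compress_apply {Λ : Set X} {M : Op X} {x y : X} (hx : x ∈ Λ) (hy : y ∈ Λ) :
    (proj Λ * M * proj Λ) x y = M x y := by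
  rw [proj, mul_mulOp_apply, mulOp_mul_apply]
  simp [hx, hy]

theorem compress_apply_of_notMem {Λ : Set X} {M : Op X} {x y : X} (hy : y ∉ Λ) :
    (proj Λ * M * proj Λ) x y = 0 := by
  rw [proj, mul_mulOp_apply]
  simp [hy]

/-! ### Potentials -/

/-- The potential `∑_{k ≥ 0} A ^ k w`. -/
def green (A : Op X) (w : X → ℝ≥0∞) : X → ℝ≥0∞ := fun x => ∑' k : ℕ, act (A ^ k) w x

/-- The partial sum `∑_{k < n} A ^ k w` of the potential. -/
def greenPartial (A : Op X) (w : X → ℝ≥0∞) (n : ℕ) : X → ℝ≥0∞ :=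
  ∑ k ∈ Finset.range n, act (A ^ k) w

theorem greenPartial_succ (A : Op X) (w : X → ℝ≥0∞) (n : ℕ) :
    greenPartial A w (n + 1) = w + act A (greenPartial A w n) := by
  rw [greenPartial, greenPartial, Finset.sum_range_succ', act_sum, add_comm]
  simp only [pow_succ', pow_zero, act_mul, act_one]

theorem greenPartial_le_succ (A : Op X) (w : X → ℝ≥0∞) (n : ℕ) :
    greenPartial A w n ≤ greenPartial A w (n + 1) := by
  rw [greenPartial, greenPartial, Finset.sum_range_succ]
  exact le_self_add

theorem greenPartial_le_green (A : Op X) (w : X → ℝ≥0∞) (n : ℕ) :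
    greenPartial A w n ≤ green A w := by
  intro x
  rw [greenPartial, Finset.sum_apply]
  exact ENNReal.sum_le_tsum _

theorem green_le_of_greenPartial_le {A : Op X} {w g : X → ℝ≥0∞}
    (h : ∀ n, greenPartial A w n ≤ g) : green A w ≤ g := by
  intro x
  rw [green, ENNReal.tsum_eq_iSup_nat]
  refine iSup_le fun n => ?_
  simpa [greenPartial] using h n x

theorem green_eq (A : Op X) (w : X → ℝ≥0∞) : green A w = w + act A (green A w) := by
  ext x
  have h : act A (green A w) x = ∑' k : ℕ, act (A ^ (k + 1)) w x := by
    simp only [pow_succ', act_mul]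
    simp only [act, green, ← ENNReal.tsum_mul_left]
    rw [ENNReal.tsum_comm]
  rw [Pi.add_apply, h, green, tsum_eq_zero_add' ENNReal.summable, pow_zero, act_one]

/-- The potential is the least supersolution of `g = w + A g`. -/
theorem green_le {A : Op X} {w g : X → ℝ≥0∞} (h : w + act A g ≤ g) : green A w ≤ g := by
  refine green_le_of_greenPartial_le fun n => ?_
  induction n with
  | zero => intro x; simp [greenPartial]
  | succ n ih =>
    rw [greenPartial_succ]
    exact (add_le_add_right (act_mono A ih) w).trans h

theorem green_smul (A : Op X) (a : ℝ≥0∞) (w : X → ℝ≥0∞) : green A (a • w) = a • green A w := by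
  ext x
  simp only [green, act_smul, Pi.smul_apply, smul_eq_mul, ENNReal.tsum_mul_left]

theorem green_apply_of_notMem {Λ : Set X} (M : Op X) (w : X → ℝ≥0∞) {x : X} (hx : x ∉ Λ) :
    green (proj Λ * M * proj Λ) w x = w x := by
  rw [green_eq, Pi.add_apply, act_compress]
  simp [hx]

/-- A function that is dominated by a finite multiple of `w`, and is a subsolution of
`s = D w + K s`, lies below `D` times the potential of `w`: the remainder `K ^ m s` tends to `0`
where the potential is finite. -/
theorem le_smul_green {K : Op X} {w s : X → ℝ≥0∞} {C D : ℝ≥0∞} (hC : C ≠ ∞) (hD : D ≠ 0)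
    (hs : s ≤ C • w) (h : s ≤ D • w + act K s) : s ≤ D • green K w := by
  have iter : ∀ m, s ≤ D • greenPartial K w m + act (K ^ m) s := by
    intro m
    induction m with
    | zero => rw [pow_zero, act_one]; exact le_add_self
    | succ m ih =>
      refine h.trans ?_
      rw [greenPartial_succ, smul_add, add_assoc, pow_succ', act_mul, ← act_smul, ← act_add]
      exact add_le_add_right (act_mono K ih) _
  intro x
  by_cases hx : green K w x = ∞
  · simp [hx, hD]
  have hb : ∀ m, s x ≤ D * green K w x + C * act (K ^ m) w x := by
    intro m
    refine (iter m x).trans (add_le_add (mul_le_mul_right (greenPartial_le_green K w m x) D) ?_)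
    have := act_mono (K ^ m) hs x
    rwa [act_smul] at this
  have ht : Filter.Tendsto (fun m => D * green K w x + C * act (K ^ m) w x) Filter.atTop
      (nhds (D * green K w x + C * 0)) :=
    tendsto_const_nhds.add
      (ENNReal.Tendsto.const_mul (ENNReal.tendsto_atTop_zero_of_tsum_ne_top hx) (Or.inr hC))
  simpa using ge_of_tendsto' ht hb

theorem sandwich_eq (c w : X → ℝ≥0) (A : Op X) :
    sandwich c A w = ∑' x, (c x : ℝ≥0∞) * act A (fun y => (w y : ℝ≥0∞)) x := by
  simp only [sandwich, act, ← ENNReal.tsum_mul_left, mul_assoc]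

theorem geomSum_eq (Λ : Set X) (c w : X → ℝ≥0) (M : Op X) :
    geomSum Λ c w M =
      ∑' x, (c x : ℝ≥0∞) * green (proj Λ * M * proj Λ) (fun y => (w y : ℝ≥0∞)) x := by
  simp only [geomSum, sandwich_eq, green, ← ENNReal.tsum_mul_left]
  rw [ENNReal.tsum_comm]

theorem geomSum_lt_top_of_smul_green_le {Λ : Set X} {c w : X → ℝ≥0} {M M' : Op X} {δ : ℝ≥0∞}
    (hδ : δ ≠ 0) (hM : geomSum Λ c w M < ∞)
    (h : δ • green (proj Λ * M' * proj Λ) (fun y => (w y : ℝ≥0∞)) ≤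
      green (proj Λ * M * proj Λ) (fun y => (w y : ℝ≥0∞))) :
    geomSum Λ c w M' < ∞ := by
  have h1 : δ * geomSum Λ c w M' ≤ geomSum Λ c w M := by
    rw [geomSum_eq, geomSum_eq, ← ENNReal.tsum_mul_left]
    refine ENNReal.tsum_le_tsum fun x => ?_
    rw [mul_left_comm]
    exact mul_le_mul_right (h x) _
  by_contra htop
  rw [not_lt, top_le_iff] at htop
  rw [htop, ENNReal.mul_top hδ, top_le_iff] at h1
  exact hM.ne h1

/-- The comparison that bounds `∑ K ^ k w` by `∑ A ^ k w`: it is enough that on `Λ` one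
application of `K` to the potential of `A` loses a fixed multiple of `w`. -/
theorem geomSum_lt_top_of_deficit {Λ : Set X} {c w : X → ℝ≥0} {M M' : Op X} {δ : ℝ≥0∞}
    (hδ : δ ≠ 0) (hδ1 : δ ≤ 1) (hM : geomSum Λ c w M < ∞)
    (h : ∀ x ∈ Λ, δ * w x + act M'
        (Λ.indicator (green (proj Λ * M * proj Λ) (fun y => (w y : ℝ≥0∞)))) x ≤
      green (proj Λ * M * proj Λ) (fun y => (w y : ℝ≥0∞)) x) :
    geomSum Λ c w M' < ∞ := by
  refine geomSum_lt_top_of_smul_green_le hδ hM ?_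
  rw [← green_smul]
  refine green_le fun x => ?_
  rw [Pi.add_apply, act_compress]
  by_cases hx : x ∈ Λ
  · simpa [hx] using h x hx
  · simpa [hx, green_apply_of_notMem M _ hx] using mul_le_mul_left hδ1 (w x : ℝ≥0∞)

theorem green_lt_top {Λ : Set X} {c w : X → ℝ≥0} {M : Op X} (hM : geomSum Λ c w M < ∞)
    {x : X} (hc : 0 < c x) :
    green (proj Λ * M * proj Λ) (fun y => (w y : ℝ≥0∞)) x < ∞ := by
  rw [geomSum_eq] at hM
  have h := (ENNReal.le_tsum x).trans_lt hM
  by_contra htop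
  rw [not_lt, top_le_iff] at htop
  rw [htop, ENNReal.mul_top (by exact_mod_cast hc.ne')] at h
  exact lt_irrefl _ h

theorem green_compress_eq {Λ : Set X} (M : Op X) (w : X → ℝ≥0∞) {x : X} (hx : x ∈ Λ) :
    green (proj Λ * M * proj Λ) w x =
      w x + act M (Λ.indicator (green (proj Λ * M * proj Λ) w)) x := by
  conv_lhs => rw [green_eq, Pi.add_apply, act_compress]
  simp [hx]

/-! ### Sequences of cleaning operators -/

theorem ofReal_one_sub_add (p : unitInterval) :
    ENNReal.ofReal (1 - (p : ℝ)) + ENNReal.ofReal (p : ℝ) = 1 := by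
  rw [← ENNReal.ofReal_add (by linarith [p.2.2]) p.2.1]
  simp

/-- Each cleaning operator lowers the potential of `α` restricted to `Λ` by at least its
strength times `w`, and later cleanings do not undo this. -/
theorem act_prod_cleaner_le {Λ : Set X} {α : X → X → ℝ≥0} {w g : X → ℝ≥0∞}
    (hg : ∀ x ∈ Λ, w x + act (toOp α) (Λ.indicator g) x ≤ g x)
    (l : List (X → unitInterval)) (hl : ∀ f ∈ l, Function.support f ⊆ Λ) :
    act (l.map (cleaner α)).prod (Λ.indicator g) ≤ Λ.indicator g ∧
    ∀ f ∈ l, ∀ x, ENNReal.ofReal (f x : ℝ) * w x +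
      act (l.map (cleaner α)).prod (Λ.indicator g) x ≤ Λ.indicator g x := by
  induction l with
  | nil => simp [act_one]
  | cons f l ih =>
    obtain ⟨ih1, ih2⟩ := ih fun f' hf' => hl f' (List.mem_cons_of_mem _ hf')
    set v := act (l.map (cleaner α)).prod (Λ.indicator g) with hv
    have hprod : act ((f :: l).map (cleaner α)).prod (Λ.indicator g) = act (cleaner α f) v := by
      rw [List.map_cons, List.prod_cons, act_mul]
    rw [hprod]
    have off : ∀ x ∉ Λ, f x = 0 := fun x hx =>
      by_contra fun h => hx (hl f List.mem_cons_self h)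
    -- The two parts of the convex combination `β_f v = (1 - f) v + f α v` are bounded separately.
    have main : ∀ x (a b d : ℝ≥0∞), a ≤ 1 → b + v x ≤ Λ.indicator g x →
        d ≤ ENNReal.ofReal (1 - (f x : ℝ)) * b + ENNReal.ofReal (f x : ℝ) * (a * w x) →
        d + act (cleaner α f) v x ≤ Λ.indicator g x := by
      intro x a b d ha hb hd
      rw [act_cleaner]
      have hf : ENNReal.ofReal (f x : ℝ) * (a * w x + act (toOp α) v x) ≤
          ENNReal.ofReal (f x : ℝ) * Λ.indicator g x := by
        by_cases hx : x ∈ Λ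
        · refine mul_le_mul_right ?_ _
          rw [Set.indicator_of_mem hx]
          refine le_trans (add_le_add ?_ (act_mono _ ih1 x)) (hg x hx)
          exact mul_le_of_le_one_left zero_le ha
        · simp [off x hx]
      calc d + (ENNReal.ofReal (1 - (f x : ℝ)) * v x
              + ENNReal.ofReal (f x : ℝ) * act (toOp α) v x)
          ≤ ENNReal.ofReal (1 - (f x : ℝ)) * (b + v x)
              + ENNReal.ofReal (f x : ℝ) * (a * w x + act (toOp α) v x) := by
            refine (add_le_add_left hd _).trans (le_of_eq ?_)
            ring
        _ ≤ ENNReal.ofReal (1 - (f x : ℝ)) * Λ.indicator g x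
              + ENNReal.ofReal (f x : ℝ) * Λ.indicator g x :=
            add_le_add (mul_le_mul_right hb _) hf
        _ = Λ.indicator g x := by rw [← add_mul, ofReal_one_sub_add, one_mul]
    refine ⟨fun x => ?_, fun f' hf' x => ?_⟩
    · simpa using main x 0 0 0 zero_le_one (by simpa using ih1 x) (by simp)
    · rcases List.mem_cons.1 hf' with rfl | hf'
      · exact main x 1 0 _ le_rfl (by simpa using ih1 x) (by simp)
      · refine main x (ENNReal.ofReal (f' x : ℝ)) (ENNReal.ofReal (f' x : ℝ) * w x) _
          (ENNReal.ofReal_le_one.2 (f' x).2.2) (ih2 f' hf' x) ?_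
        rw [← add_mul, ofReal_one_sub_add, one_mul]

theorem CondA.condC {Λ : Set X} {c w : X → ℝ≥0} {α : X → X → ℝ≥0} (h : CondA Λ c w α) :
    CondC Λ c w α := by
  intro m f hf ⟨ε, hε, hsum⟩
  have hm : (0 : ℝ) < m + 1 := by positivity
  have hpos : 0 < min 1 (ε / (m + 1)) := lt_min one_pos (by positivity)
  refine geomSum_lt_top_of_deficit (δ := ENNReal.ofReal (min 1 (ε / (m + 1))))
    (by simpa using hpos) (ENNReal.ofReal_le_one.2 (min_le_left _ _)) h fun x hx => ?_
  set g := green (proj Λ * toOp α * proj Λ) (fun y => (w y : ℝ≥0∞))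
  have key := act_prod_cleaner_le (Λ := Λ) (α := α) (w := fun y => (w y : ℝ≥0∞)) (g := g)
    (fun x hx => (green_compress_eq (toOp α) _ hx).ge) (List.ofFn f)
    (by simpa [List.mem_ofFn] using hf)
  rw [List.map_ofFn] at key
  -- The functions sum to at least `ε` at `x`, so one of them is at least `ε / (m + 1)` there.
  obtain ⟨i, hi⟩ : ∃ i, ε / (m + 1) ≤ (f i x : ℝ) := by
    by_contra! hlt
    have h1 : ε ≤ ∑ i, (f i x : ℝ) := by simpa [hx] using hsum x
    have h2 : ∑ i, (f i x : ℝ) ≤ m * (ε / (m + 1)) := by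
      simpa using Finset.sum_le_sum fun i (_ : i ∈ Finset.univ) => (hlt i).le
    have h3 : m * (ε / (m + 1)) < ε := by
      rw [← mul_div_assoc, div_lt_iff₀ hm]
      linarith
    linarith
  have := key.2 (f i) (List.mem_ofFn.2 ⟨i, rfl⟩) x
  rw [Set.indicator_of_mem hx] at this
  refine le_trans (add_le_add_left (mul_le_mul_left ?_ _) _) this
  exact ENNReal.ofReal_le_ofReal ((min_le_right _ _).trans hi)

theorem CondC.condB {Λ : Set X} {c w : X → ℝ≥0} {α : X → X → ℝ≥0} (h : CondC Λ c w α) :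
    CondB Λ c w α := by
  intro f hf hε
  simpa using h 1 (fun _ => f) (fun _ => hf.le) (by simpa using hε)

/-- The indicator function of a set, with values in the unit interval. -/
def indicatorUnit (Λ : Set X) : X → unitInterval := Λ.indicator 1

theorem coe_indicatorUnit (Λ : Set X) (x : X) :
    (indicatorUnit Λ x : ℝ) = Λ.indicator 1 x := by
  by_cases hx : x ∈ Λ <;> simp [indicatorUnit, hx]

theorem support_indicatorUnit (Λ : Set X) : Function.support (indicatorUnit Λ) = Λ := by
  ext x
  by_cases hx : x ∈ Λ <;> simp [indicatorUnit, hx]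

theorem CondB.condB' {Λ : Set X} {c w : X → ℝ≥0} {α : X → X → ℝ≥0} (h : CondB Λ c w α) :
    CondB' Λ c w α :=
  ⟨indicatorUnit Λ, support_indicatorUnit Λ, h _ (support_indicatorUnit Λ)
    ⟨1, one_pos, fun x => by rw [coe_indicatorUnit, one_mul]⟩⟩

theorem CondB'.condC' {Λ : Set X} {c w : X → ℝ≥0} {α : X → X → ℝ≥0} (h : CondB' Λ c w α) :
    CondC' Λ c w α := by
  obtain ⟨f, hf, hsum⟩ := h
  exact ⟨1, fun _ => f, fun _ => hf.le, by simpa using hsum⟩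

/-- On `Λ` the potential `u` of `I_Λ β_h I_Λ` satisfies `u = w + (1 - h) u + h α u`; being finite
there, it satisfies `h u ≥ h (w + α u)`, so it is a supersolution for `I_Λ α I_Λ`. -/
theorem CondB'.condA {Λ : Set X} {c w : X → ℝ≥0} {α : X → X → ℝ≥0} (hc : ∀ x ∈ Λ, 0 < c x)
    (h : CondB' Λ c w α) : CondA Λ c w α := by
  obtain ⟨f, hf, hsum⟩ := h
  refine geomSum_lt_top_of_smul_green_le one_ne_zero hsum ?_
  rw [one_smul]
  set u := green (proj Λ * cleaner α f * proj Λ) (fun y => (w y : ℝ≥0∞)) with hu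
  refine green_le fun x => ?_
  rw [Pi.add_apply, act_compress]
  by_cases hx : x ∈ Λ
  · rw [Set.indicator_of_mem hx]
    have hfin : u x < ∞ := green_lt_top hsum (hc x hx)
    have heq := green_compress_eq (cleaner α f) (fun y => (w y : ℝ≥0∞)) hx
    rw [← hu, act_cleaner, Set.indicator_of_mem hx] at heq
    set p := ENNReal.ofReal (f x : ℝ) with hp
    set q := ENNReal.ofReal (1 - (f x : ℝ)) with hq
    have hpq : q + p = 1 := ofReal_one_sub_add (f x)
    have hp0 : p ≠ 0 := by
      have h0 : f x ≠ 0 := by rw [← hf] at hx; exact hx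
      rw [hp, Ne, ENNReal.ofReal_eq_zero, not_le]
      exact lt_of_le_of_ne (f x).2.1 fun h => h0 (Subtype.ext h.symm)
    have hp1 : p ≤ 1 := hpq ▸ le_add_self
    have hqu : q * u x ≠ ∞ := ENNReal.mul_ne_top ENNReal.ofReal_ne_top hfin.ne
    have h1 : q * u x + p * (w x + act (toOp α) (Λ.indicator u) x) ≤ q * u x + p * u x :=
      calc q * u x + p * (w x + act (toOp α) (Λ.indicator u) x)
          = p * w x + (q * u x + p * act (toOp α) (Λ.indicator u) x) := by ring
        _ ≤ w x + (q * u x + p * act (toOp α) (Λ.indicator u) x) :=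
            add_le_add_left (mul_le_of_le_one_left zero_le hp1) _
        _ = q * u x + p * u x := by rw [← heq, ← add_mul, hpq, one_mul]
    have h2 := (ENNReal.add_le_add_iff_left hqu).1 h1
    exact (ENNReal.mul_le_mul_iff_right hp0 ENNReal.ofReal_ne_top).1 h2
  · simp [hx, hu, green_apply_of_notMem _ _ hx]

/-! ### Sums over the tree of markers -/

/-- The product `A x x₁ ⋯ A x_{k-1} x_k * v x_k` contributed by the path `(x, x₁, …, x_k)`. -/
def pathVal (A : Op X) (v : X → ℝ≥0∞) : X → List X → ℝ≥0∞
  | x, [] => v x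
  | x, y :: t => A x y * pathVal A v y t

/-- `(T_φ v) x`, as a sum over all markers starting at `x`; a marker `(x, x₁, …, x_k)` is given by
`x` and `[x₁, …, x_k]`. -/
def pathSum (A : Op X) (φ : X → List X → ℝ≥0∞) (v : X → ℝ≥0∞) (x : X) : ℝ≥0∞ :=
  ∑' t : List X, φ x t * pathVal A v x t

/-- The cloud seen from the marker `(x)`: `η ↦ φ (x η)`. -/
def shift (φ : X → List X → ℝ≥0∞) (x : X) : X → List X → ℝ≥0∞ := fun y t => φ x (y :: t)

/-- The cumulative distribution `∑_{σ ≼ η} φ σ` of `η = (x, x₁, …, x_k)`, by recursion on `η`. -/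
def cum (φ : X → List X → ℝ≥0∞) : X → List X → ℝ≥0∞
  | x, [] => φ x []
  | x, y :: t => φ x [] + cum (shift φ x) y t

theorem tsum_list (f : List X → ℝ≥0∞) : ∑' t, f t = f [] + ∑' y, ∑' t, f (y :: t) := by
  let e : Unit ⊕ X × List X ≃ List X :=
    { toFun := Sum.elim (fun _ => []) fun p => p.1 :: p.2
      invFun := fun l => match l with
        | [] => Sum.inl ()
        | y :: t => Sum.inr (y, t)
      left_inv := by rintro (_ | ⟨y, t⟩) <;> rfl
      right_inv := by rintro (_ | ⟨y, t⟩) <;> rfl }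
  rw [← e.tsum_eq, ENNReal.summable.tsum_sum ENNReal.summable, ← ENNReal.tsum_prod]
  simp [e]

theorem pathSum_eq (A : Op X) (φ : X → List X → ℝ≥0∞) (v : X → ℝ≥0∞) (x : X) :
    pathSum A φ v x = φ x [] * v x + act A (pathSum A (shift φ x) v) x := by
  rw [pathSum, tsum_list]
  congr 1
  refine tsum_congr fun y => ?_
  rw [pathSum, ← ENNReal.tsum_mul_left]
  refine tsum_congr fun t => ?_
  rw [pathVal, shift, mul_left_comm]

theorem act_pathOp (α : X → X → ℝ≥0) (v : X → ℝ≥0∞) (t : List X) (z : X) :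
    act (pathOp α z t) v = Set.indicator {z} fun _ => pathVal (toOp α) v z t := by
  induction t generalizing z with
  | nil =>
    rw [pathOp, act_proj]
    ext x
    by_cases hx : x = z <;> simp [hx, pathVal]
  | cons y t ih =>
    rw [pathOp, act_mul, act_mul, act_proj, ih]
    ext x
    by_cases hx : x = z
    · subst hx
      rw [Set.indicator_of_mem (Set.mem_singleton x), Set.indicator_of_mem (Set.mem_singleton x),
        act, tsum_eq_single y]
      · simp [pathVal]
      · intro z hz
        simp [hz]
    · simp [hx]

/-- A cloud as a function on pairs (first entry, remaining entries), with values in `[0, ∞]`. -/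
def cloudFun (ν : Cloud X) : X → List X → ℝ≥0∞ := fun x t => ENNReal.ofReal (ν ⟨x, t⟩)

theorem act_cloudOp (α : X → X → ℝ≥0) (ν : Cloud X) (v : X → ℝ≥0∞) :
    act (cloudOp α ν) v = pathSum (toOp α) (cloudFun ν) v := by
  ext x
  let e : X × List X ≃ Marker X :=
    { toFun := fun p => ⟨p.1, p.2⟩
      invFun := fun η => (η.first, η.rest)
      left_inv := fun _ => rfl
      right_inv := fun _ => rfl }
  have h : act (cloudOp α ν) v x =
      ∑' η : Marker X, ENNReal.ofReal (ν η) * act (pathOp α η.first η.rest) v x := by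
    simp only [act, cloudOp, ← ENNReal.tsum_mul_left, ← ENNReal.tsum_mul_right]
    rw [ENNReal.tsum_comm]
    simp only [mul_assoc]
  rw [h, ← e.tsum_eq, ENNReal.tsum_prod', tsum_eq_single x]
  · simp [act_pathOp, e, pathSum, cloudFun]
  · intro z hz
    simp [act_pathOp, e, hz.symm]

theorem cum_cloudFun {ν : Cloud X} (hν : 0 ≤ ν) (x : X) (t : List X) :
    cum (cloudFun ν) x t = ENNReal.ofReal (cumul ν ⟨x, t⟩) := by
  have key : ∀ (t : List X) (φ : X → List X → ℝ≥0∞) (x : X),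
      cum φ x t = ∑ j ∈ Finset.range (t.length + 1), φ x (t.take j) := by
    intro t
    induction t with
    | nil => simp [cum]
    | cons y t ih =>
      intro φ x
      rw [Finset.sum_range_succ', cum, ih, add_comm]
      simp [shift]
  rw [key, cumul, ENNReal.ofReal_sum_of_nonneg fun _ _ => hν _]
  rfl

theorem pathSum_le_of_level_lt {A : Op X} {g : X → ℝ≥0∞} (hg : act A g ≤ g) (N : ℕ)
    (φ : X → List X → ℝ≥0∞) (x : X) (a : ℝ≥0∞) (ha : a ≠ ∞)
    (hN : ∀ t, N ≤ t.length → φ x t = 0) (hcum : ∀ t, cum φ x t ≤ a) :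
    pathSum A φ g x ≤ a * g x := by
  induction N generalizing φ x a with
  | zero => simp [pathSum, hN]
  | succ N ih =>
    have h0 : φ x [] ≤ a := hcum []
    have h0' : φ x [] ≠ ∞ := ne_top_of_le_ne_top ha h0
    have h1 : pathSum A (shift φ x) g ≤ (a - φ x []) • g := by
      intro y
      refine ih (shift φ x) y _ (ne_top_of_le_ne_top ha tsub_le_self) (fun t ht => ?_) fun t => ?_
      · exact hN (y :: t) (by simpa using ht)
      · exact ENNReal.le_sub_of_add_le_left h0' (hcum (y :: t))
    calc pathSum A φ g x = φ x [] * g x + act A (pathSum A (shift φ x) g) x := pathSum_eq ..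
      _ ≤ φ x [] * g x + (a - φ x []) * g x := by
        refine add_le_add_right ((act_mono A h1 x).trans ?_) _
        rw [act_smul]
        exact mul_le_mul_right (hg x) _
      _ = a * g x := by rw [← add_mul, add_tsub_cancel_of_le h0]

/-- Superharmonic functions decrease on average along the tree: if the total mass of `φ` on each
branch is at most `a`, then `T_φ g ≤ a g`. -/
theorem pathSum_le {A : Op X} {g : X → ℝ≥0∞} (hg : act A g ≤ g)
    (φ : X → List X → ℝ≥0∞) (x : X) (a : ℝ≥0∞) (ha : a ≠ ∞) (hcum : ∀ t, cum φ x t ≤ a) :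
    pathSum A φ g x ≤ a * g x := by
  classical
  rw [pathSum, ENNReal.tsum_eq_iSup_sum]
  refine iSup_le fun s => ?_
  -- Only finitely many markers count, hence only finitely many levels.
  obtain ⟨N, hN⟩ : ∃ N, ∀ t ∈ s, t.length < N :=
    ⟨s.sup List.length + 1, fun t ht => Nat.lt_succ_of_le (Finset.le_sup (f := List.length) ht)⟩
  let ψ : X → List X → ℝ≥0∞ := fun y t => if t.length < N then φ y t else 0
  have mono : ∀ (t : List X) (φ₁ φ₂ : X → List X → ℝ≥0∞) (y : X), φ₁ ≤ φ₂ →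
      cum φ₁ y t ≤ cum φ₂ y t := by
    intro t
    induction t with
    | nil => exact fun _ _ y h => h y []
    | cons z t ih => exact fun _ _ y h => add_le_add (h y []) (ih _ _ _ fun u t => h y (u :: t))
  have hψ : ψ ≤ φ := by
    intro y t
    by_cases h : t.length < N <;> simp [ψ, h]
  calc ∑ t ∈ s, φ x t * pathVal A g x t = ∑ t ∈ s, ψ x t * pathVal A g x t :=
        Finset.sum_congr rfl fun t ht => by simp [ψ, hN t ht]
    _ ≤ pathSum A ψ g x := ENNReal.sum_le_tsum _
    _ ≤ a * g x := pathSum_le_of_level_lt hg N ψ x a ha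
        (fun t ht => by simp [ψ, ht.not_gt]) fun t => (mono t _ _ x hψ).trans (hcum t)

/-- Converse comparison: if each branch carries mass at least `a` up to level `N`, then a
subsolution of `g = w + A g` exceeds `T_φ g` by at most what is collected from `w` in the
first `N` steps. -/
theorem le_pathSum {A : Op X} {g w : X → ℝ≥0∞} (hg : g ≤ w + act A g) (N : ℕ)
    (φ : X → List X → ℝ≥0∞) (x : X) (a : ℝ≥0∞)
    (hcum : ∀ t, t.length = N → a ≤ cum φ x t) :
    a * g x ≤ a * greenPartial A w N x + pathSum A φ g x := by
  induction N generalizing φ x a with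
  | zero =>
    rw [pathSum_eq]
    refine le_trans ?_ (le_self_add.trans le_add_self)
    exact mul_le_mul_left (hcum [] rfl) _
  | succ N ih =>
    rw [pathSum_eq]
    rcases le_total a (φ x []) with h | h
    · exact (mul_le_mul_left h _).trans (le_self_add.trans le_add_self)
    set b := a - φ x [] with hb
    have hab : φ x [] + b = a := add_tsub_cancel_of_le h
    have h1 : b • g ≤ b • greenPartial A w N + pathSum A (shift φ x) g := fun y =>
      ih (shift φ x) y b fun t ht => tsub_le_iff_left.2 (hcum (y :: t) (by simp [ht]))
    have h2 := act_mono A h1 x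
    rw [act_add, act_smul, act_smul] at h2
    calc a * g x = φ x [] * g x + b * g x := by rw [← add_mul, hab]
      _ ≤ φ x [] * g x + b * (w x + act A g x) :=
        add_le_add_right (mul_le_mul_right (hg x) b) _
      _ ≤ φ x [] * g x + (b * w x + (b * act A (greenPartial A w N) x +
            act A (pathSum A (shift φ x) g) x)) := by
        rw [mul_add]
        exact add_le_add_right (add_le_add_right h2 _) _
      _ = b * greenPartial A w (N + 1) x +
            (φ x [] * g x + act A (pathSum A (shift φ x) g) x) := by
        rw [greenPartial_succ, Pi.add_apply]
        ring
      _ ≤ _ := add_le_add_left (mul_le_mul_left tsub_le_self _) _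

theorem pathVal_compress {Λ : Set X} {B : Op X} {v : X → ℝ≥0∞} (t : List X)
    (φ : X → List X → ℝ≥0∞) (x : X) (hx : x ∈ Λ)
    (hφ : (∃ y ∈ (x :: t).dropLast, y ∉ Λ) → φ x t = 0) :
    φ x t * pathVal B (Λ.indicator v) x t = φ x t * pathVal (proj Λ * B * proj Λ) v x t := by
  induction t generalizing φ x with
  | nil => simp [pathVal, hx]
  | cons y t ih =>
    rw [pathVal, pathVal]
    by_cases hy : y ∈ Λ
    · rw [compress_apply hx hy, mul_left_comm, mul_left_comm (φ x _)]
      congr 1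
      refine ih (shift φ x) y hy ?_
      rintro ⟨z, hz, hzΛ⟩
      exact hφ ⟨z, List.mem_cons_of_mem _ hz, hzΛ⟩
    · rw [compress_apply_of_notMem hy]
      cases t with
      | nil => simp [pathVal, hy]
      | cons z t => rw [hφ ⟨y, by simp, hy⟩, zero_mul, zero_mul]

/-- For a cloud carried by `Λ`, compressing `T_ν` to `Λ` amounts to compressing `α`. -/
theorem act_cloudOp_indicator {Λ : Set X} {α : X → X → ℝ≥0} {ν : Cloud X}
    (hΛ : CarriedBy Λ ν) (v : X → ℝ≥0∞) {x : X} (hx : x ∈ Λ) :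
    act (cloudOp α ν) (Λ.indicator v) x =
      pathSum (proj Λ * toOp α * proj Λ) (cloudFun ν) v x := by
  rw [act_cloudOp]
  refine tsum_congr fun t => pathVal_compress t _ x hx fun h => ?_
  rw [cloudFun, hΛ ⟨x, t⟩ h, ENNReal.ofReal_zero]

/-! ### Subunit clouds -/

theorem cumul_le_one_of_cloudNorm_le {ν : Cloud X} (hν : 0 ≤ ν) (h : cloudNorm ν ≤ 1)
    (η : Marker X) : ENNReal.ofReal (cumul ν η) ≤ 1 := by
  refine le_trans (le_of_eq ?_) ((le_iSup_iff.2 fun b hb => hb η).trans h)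
  rw [cumul]
  congr 1
  exact Finset.sum_congr rfl fun j _ => (abs_of_nonneg (hν _)).symm

theorem CondA.condD {Λ : Set X} {c w : X → ℝ≥0} {α : X → X → ℝ≥0} (h : CondA Λ c w α) :
    CondD Λ c w α := by
  intro ν hν hΛ hnorm ⟨ε, hε, hνε⟩
  refine geomSum_lt_top_of_deficit (δ := ENNReal.ofReal (min 1 ε))
    (by simpa using hε) (ENNReal.ofReal_le_one.2 (min_le_left _ _)) h fun x hx => ?_
  rw [act_cloudOp_indicator hΛ _ hx]
  set A := proj Λ * toOp α * proj Λ
  set g := green A (fun y => (w y : ℝ≥0∞))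
  have hg : g = (fun y => (w y : ℝ≥0∞)) + act A g := green_eq _ _
  have hsuper : act A g ≤ g := by
    conv_rhs => rw [hg]
    exact le_add_self
  have hcum : ∀ t, cum (cloudFun ν) x t ≤ 1 := fun t => by
    rw [cum_cloudFun hν]
    exact cumul_le_one_of_cloudNorm_le hν hnorm _
  set q := cloudFun ν x [] with hq
  have hq1 : q ≤ 1 := hcum []
  have hqt : q ≠ ∞ := ne_top_of_le_ne_top ENNReal.one_ne_top hq1
  -- Mass at least `ε` leaves the root `(x)`, and collects `w x` on the way.
  have hδ : ENNReal.ofReal (min 1 ε) ≤ 1 - q := by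
    refine ENNReal.le_sub_of_add_le_left hqt ?_
    rw [hq, cloudFun, ← ENNReal.ofReal_add (hν _) (le_min zero_le_one hε.le),
      ENNReal.ofReal_le_one]
    linarith [hνε x hx, min_le_right 1 ε]
  have h1 : pathSum A (shift (cloudFun ν) x) g ≤ (1 - q) • g := fun y =>
    pathSum_le hsuper _ y _ (ne_top_of_le_ne_top ENNReal.one_ne_top tsub_le_self)
      fun t => ENNReal.le_sub_of_add_le_left hqt (hcum (y :: t))
  have h2 := act_mono A h1 x
  rw [act_smul] at h2
  calc ENNReal.ofReal (min 1 ε) * w x + pathSum A (cloudFun ν) g x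
      ≤ (1 - q) * w x + (q * g x + (1 - q) * act A g x) := by
        rw [pathSum_eq]
        exact add_le_add (mul_le_mul_left hδ _) (add_le_add_right h2 _)
    _ = q * g x + (1 - q) * (w x + act A g x) := by ring
    _ = q * g x + (1 - q) * g x := by
        have : g x = w x + act A g x := congrFun hg x
        rw [← this]
    _ = g x := by rw [← add_mul, add_tsub_cancel_of_le hq1, one_mul]

/-- The cloud with `ν (x, y) = 1` for `x ∈ Λ`, and `0` elsewhere; then `T_ν = I_Λ α`. -/
def stepCloud (Λ : Set X) : Cloud X := fun η =>
  match η with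
  | ⟨x, [_]⟩ => Λ.indicator 1 x
  | _ => 0

theorem stepCloud_nonneg (Λ : Set X) : 0 ≤ stepCloud Λ := by
  rintro ⟨x, _ | ⟨y, _ | ⟨z, t⟩⟩⟩
  · exact le_rfl
  · exact Set.indicator_nonneg (fun _ _ => zero_le_one) x
  · exact le_rfl

theorem act_cloudOp_stepCloud {Λ : Set X} (α : X → X → ℝ≥0) (v : X → ℝ≥0∞) {x : X} (hx : x ∈ Λ) :
    act (cloudOp α (stepCloud Λ)) v x = act (toOp α) v x := by
  have h : ∀ y, pathSum (toOp α) (shift (cloudFun (stepCloud Λ)) x) v y = v y := by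
    intro y
    rw [pathSum, tsum_eq_single []]
    · simp [shift, cloudFun, stepCloud, hx, pathVal]
    · rintro (_ | ⟨z, t⟩) ht
      · exact absurd rfl ht
      · simp [shift, cloudFun, stepCloud]
  rw [act_cloudOp, pathSum_eq, funext h]
  simp [cloudFun, stepCloud]

theorem CondD.condA {Λ : Set X} {c w : X → ℝ≥0} {α : X → X → ℝ≥0} (h : CondD Λ c w α) :
    CondA Λ c w α := by
  have hsum := h (stepCloud Λ) (stepCloud_nonneg Λ) ?_ ?_ ⟨1, one_pos, fun x _ => ?_⟩
  · have heq : proj Λ * cloudOp α (stepCloud Λ) * proj Λ = proj Λ * toOp α * proj Λ := by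
      refine ext_of_act fun v => ?_
      rw [act_compress, act_compress]
      ext x
      by_cases hx : x ∈ Λ
      · rw [Set.indicator_of_mem hx, Set.indicator_of_mem hx, act_cloudOp_stepCloud α _ hx]
      · simp [hx]
    rw [geomSum, heq] at hsum
    exact hsum
  · rintro ⟨x, _ | ⟨y, _ | ⟨z, t⟩⟩⟩ hη
    · rfl
    · obtain ⟨z, hz, hzΛ⟩ := hη
      obtain rfl : z = x := by simpa [Marker.toList] using hz
      simp [stepCloud, hzΛ]
    · rfl
  · refine iSup_le fun η => ENNReal.ofReal_le_one.2 ?_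
    -- At most one term of the sum is nonzero, the one of level `1`.
    have hj : ∀ j ∈ Finset.range (η.level + 1), j ≠ 1 → |stepCloud Λ (η.take j)| = 0 := by
      intro j hj h1
      obtain ⟨x, t⟩ := η
      have hlen : (t.take j).length = j := by
        rw [List.length_take]
        exact min_eq_left (Nat.lt_succ_iff.1 (Finset.mem_range.1 hj))
      have h0 : ∀ l : List X, l.length ≠ 1 → stepCloud Λ ⟨x, l⟩ = 0 := by
        rintro (_ | ⟨y, _ | ⟨z, l⟩⟩) hl
        · rfl
        · exact absurd rfl hl
        · rfl
      rw [Marker.take, h0 _ (by rw [hlen]; exact h1), abs_zero]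
    have hle : ∀ η : Marker X, |stepCloud Λ η| ≤ 1 := by
      rintro ⟨x, _ | ⟨y, _ | ⟨z, t⟩⟩⟩
      · simp [stepCloud]
      · by_cases hx : x ∈ Λ <;> simp [stepCloud, hx]
      · simp [stepCloud]
    by_cases h1 : 1 ∈ Finset.range (η.level + 1)
    · rw [Finset.sum_eq_single_of_mem 1 h1 hj]
      exact hle _
    · rw [Finset.sum_eq_zero fun j hjm => hj j hjm fun h => h1 (h ▸ hjm)]
      exact zero_le_one
  · simp [stepCloud]

/-! ### Clouds of products of cleaning operators -/

/-- The cloud that stops at `(x₀)` with probability `1 - f x₀` and else moves to the next entry,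
followed by `ν`. -/
def cleanCloud (f : X → unitInterval) (ν : Cloud X) : Cloud X := fun η =>
  match η with
  | ⟨x, []⟩ => (1 - (f x : ℝ)) * ν ⟨x, []⟩
  | ⟨x, y :: t⟩ => (1 - (f x : ℝ)) * ν ⟨x, y :: t⟩ + (f x : ℝ) * ν ⟨y, t⟩

/-- The cloud with mass `1` at each marker of level `0`; its operator is the identity. -/
def unitCloud : Cloud X := fun η =>
  match η with
  | ⟨_, []⟩ => 1
  | _ => 0

theorem cloudOp_unitCloud (α : X → X → ℝ≥0) : cloudOp α unitCloud = 1 := by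
  refine ext_of_act fun v => ?_
  rw [act_one, act_cloudOp]
  ext x
  rw [pathSum, tsum_eq_single []]
  · simp [cloudFun, unitCloud, pathVal]
  · rintro (_ | ⟨z, t⟩) ht
    · exact absurd rfl ht
    · simp [cloudFun, unitCloud]

theorem cloudOp_cleanCloud (α : X → X → ℝ≥0) (f : X → unitInterval) {ν : Cloud X} (hν : 0 ≤ ν) :
    cloudOp α (cleanCloud f ν) = cleaner α f * cloudOp α ν := by
  refine ext_of_act fun v => ?_
  rw [act_mul, act_cloudOp, act_cloudOp]
  ext x
  have hq : 0 ≤ 1 - (f x : ℝ) := by linarith [(f x).2.2]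
  have hp : 0 ≤ (f x : ℝ) := (f x).2.1
  have h0 : cloudFun (cleanCloud f ν) x [] = ENNReal.ofReal (1 - (f x : ℝ)) * cloudFun ν x [] := by
    simp only [cloudFun, cleanCloud]
    rw [ENNReal.ofReal_mul hq]
  have h1 : pathSum (toOp α) (shift (cloudFun (cleanCloud f ν)) x) v =
      ENNReal.ofReal (1 - (f x : ℝ)) • pathSum (toOp α) (shift (cloudFun ν) x) v +
        ENNReal.ofReal (f x : ℝ) • pathSum (toOp α) (cloudFun ν) v := by
    ext y
    simp only [pathSum, Pi.add_apply, Pi.smul_apply, smul_eq_mul, ← ENNReal.tsum_mul_left,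
      ← ENNReal.tsum_add]
    refine tsum_congr fun t => ?_
    simp only [shift, cloudFun, cleanCloud]
    rw [ENNReal.ofReal_add (mul_nonneg hq (hν _)) (mul_nonneg hp (hν _)), ENNReal.ofReal_mul hq,
      ENNReal.ofReal_mul hp]
    ring
  rw [pathSum_eq, h0, h1, act_cleaner, pathSum_eq, act_add, act_smul, act_smul, Pi.add_apply,
    Pi.smul_apply, Pi.smul_apply, smul_eq_mul, smul_eq_mul]
  ring

theorem cumul_cons (ν : Cloud X) (x y : X) (t : List X) :
    cumul ν ⟨x, y :: t⟩ =
      ν ⟨x, []⟩ + ∑ j ∈ Finset.range (t.length + 1), ν ⟨x, y :: t.take j⟩ := by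
  rw [cumul, Finset.sum_range_succ', add_comm]
  rfl

theorem cumul_nil (ν : Cloud X) (x : X) : cumul ν ⟨x, []⟩ = ν ⟨x, []⟩ := by
  simp [cumul, Marker.level, Marker.take]

theorem cumul_cleanCloud_nil (f : X → unitInterval) (ν : Cloud X) (x : X) :
    cumul (cleanCloud f ν) ⟨x, []⟩ = (1 - (f x : ℝ)) * cumul ν ⟨x, []⟩ := by
  simp only [cumul_nil, cleanCloud]

theorem cumul_cleanCloud_cons (f : X → unitInterval) (ν : Cloud X) (x y : X) (t : List X) :
    cumul (cleanCloud f ν) ⟨x, y :: t⟩ =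
      (1 - (f x : ℝ)) * cumul ν ⟨x, y :: t⟩ + (f x : ℝ) * cumul ν ⟨y, t⟩ := by
  rw [cumul_cons, cumul_cons]
  simp only [cleanCloud, Finset.sum_add_distrib, ← Finset.mul_sum]
  rw [mul_add, add_assoc]
  rfl

theorem cumul_unitCloud (η : Marker X) : cumul unitCloud η = 1 := by
  obtain ⟨x, _ | ⟨y, t⟩⟩ := η
  · rw [cumul_nil]
    rfl
  · rw [cumul_cons]
    simp [unitCloud]

theorem mem_classS_one {ν : Cloud X} (hν : 0 ≤ ν) (hle : ∀ η, cumul ν η ≤ 1) (N : ℕ)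
    (hN : ∀ η : Marker X, N ≤ η.level → cumul ν η = 1) : ν ∈ ClassS 1 := by
  refine ⟨hν, fun η => le_antisymm ?_ ?_⟩
  · exact iSup₂_le fun η' _ => by simpa using hle η'
  · -- Any marker can be prolonged beyond level `N`, by repeating its first entry.
    refine le_iSup₂_of_le ⟨η.first, η.rest ++ List.replicate N η.first⟩ ⟨η.level, ?_, ?_⟩ ?_
    · simp [Marker.level]
    · simp [Marker.level, Marker.take]
    · rw [hN _ (by simp [Marker.level])]
      simp

/-- A product of cleaning operators supported in `Λ` is the operator of a cloud that is carried
by `Λ` and has reached total mass `1` on each branch after finitely many levels. -/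
theorem exists_cloudOp_eq_prod {Λ : Set X} (α : X → X → ℝ≥0) (l : List (X → unitInterval))
    (hl : ∀ f ∈ l, Function.support f ⊆ Λ) :
    ∃ ν : Cloud X, 0 ≤ ν ∧ CarriedBy Λ ν ∧ (∀ η, cumul ν η ≤ 1) ∧
      (∀ η : Marker X, l.length ≤ η.level → cumul ν η = 1) ∧
      (∀ η : Marker X, l.length < η.level → ν η = 0) ∧
      cloudOp α ν = (l.map (cleaner α)).prod := by
  induction l with
  | nil =>
    refine ⟨unitCloud, ?_, ?_, fun η => (cumul_unitCloud η).le, fun η _ => cumul_unitCloud η,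
      ?_, cloudOp_unitCloud α⟩
    · rintro ⟨x, _ | ⟨y, t⟩⟩
      · exact zero_le_one
      · exact le_rfl
    · rintro ⟨x, _ | ⟨y, t⟩⟩ hη
      · simp [Marker.toList] at hη
      · rfl
    · rintro ⟨x, _ | ⟨y, t⟩⟩ hη
      · simp [Marker.level] at hη
      · rfl
  | cons f l ih =>
    obtain ⟨ν, hν, hΛ, hle, heq, hlev, hop⟩ := ih fun f' hf' => hl f' (List.mem_cons_of_mem _ hf')
    have hq : ∀ x, 0 ≤ 1 - (f x : ℝ) := fun x => by linarith [(f x).2.2]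
    have hp : ∀ x, 0 ≤ (f x : ℝ) := fun x => (f x).2.1
    refine ⟨cleanCloud f ν, ?_, ?_, ?_, ?_, ?_, ?_⟩
    · rintro ⟨x, _ | ⟨y, t⟩⟩
      · exact mul_nonneg (hq x) (hν _)
      · exact add_nonneg (mul_nonneg (hq x) (hν _)) (mul_nonneg (hp x) (hν _))
    · rintro ⟨x, _ | ⟨y, t⟩⟩ ⟨z, hz, hzΛ⟩
      · simp [Marker.toList] at hz
      · have h1 : ν ⟨x, y :: t⟩ = 0 := hΛ _ ⟨z, hz, hzΛ⟩
        have h2 : (f x : ℝ) * ν ⟨y, t⟩ = 0 := by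
          rcases List.mem_cons.1 (show z ∈ x :: (y :: t).dropLast from hz) with rfl | hz'
          · have : f z = 0 := by_contra fun h => hzΛ (hl f List.mem_cons_self h)
            rw [this]
            simp
          · rw [hΛ ⟨y, t⟩ ⟨z, hz', hzΛ⟩, mul_zero]
        simp only [cleanCloud]
        rw [h1, h2, mul_zero, zero_add]
    · rintro ⟨x, _ | ⟨y, t⟩⟩
      · rw [cumul_cleanCloud_nil]
        have h0 : 0 ≤ cumul ν ⟨x, []⟩ := by rw [cumul_nil]; exact hν _
        exact mul_le_one₀ (by linarith [hp x]) h0 (hle _)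
      · rw [cumul_cleanCloud_cons]
        nlinarith [mul_le_mul_of_nonneg_left (hle ⟨x, y :: t⟩) (hq x),
          mul_le_mul_of_nonneg_left (hle ⟨y, t⟩) (hp x)]
    · rintro ⟨x, _ | ⟨y, t⟩⟩ hη
      · simp [Marker.level] at hη
      · have hη' : l.length ≤ t.length := by simpa [Marker.level] using hη
        rw [cumul_cleanCloud_cons, heq ⟨y, t⟩ hη',
          heq ⟨x, y :: t⟩ (hη'.trans (Nat.le_succ _))]
        ring
    · rintro ⟨x, _ | ⟨y, t⟩⟩ hη
      · simp [Marker.level] at hη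
      · have hη' : l.length < t.length := by simpa [Marker.level] using hη
        simp only [cleanCloud]
        rw [hlev ⟨y, t⟩ hη', hlev ⟨x, y :: t⟩ (hη'.trans (Nat.lt_succ_self _))]
        ring
    · rw [cloudOp_cleanCloud α f hν, hop, List.map_cons, List.prod_cons]

theorem CondC'.condD' {Λ : Set X} {c w : X → ℝ≥0} {α : X → X → ℝ≥0} (h : CondC' Λ c w α) :
    CondD' Λ c w α := by
  obtain ⟨m, f, hf, hsum⟩ := h
  obtain ⟨ν, hν, hΛ, hle, heq, hlev, hop⟩ := exists_cloudOp_eq_prod α (List.ofFn f)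
    (by simpa [List.mem_ofFn] using hf)
  refine ⟨ν, mem_classS_one hν hle _ heq, hΛ, ⟨_, hlev⟩, ?_⟩
  rw [hop, List.map_ofFn]
  exact hsum

/-! ### Balanced clouds on finitely many levels -/

theorem one_le_cumul_of_level_eq {ν : Cloud X} (hS : ν ∈ ClassS 1) {N : ℕ}
    (hN : ∀ η : Marker X, N < η.level → ν η = 0) (η : Marker X) (hη : η.level = N) :
    1 ≤ ENNReal.ofReal (cumul ν η) := by
  have h := hS.2 η
  rw [ENNReal.coe_one] at h
  rw [← h]
  refine iSup₂_le fun η' hanc => ENNReal.ofReal_le_ofReal (le_of_eq ?_)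
  obtain ⟨j, hj, rfl⟩ := hanc
  have hjN : j = N := by
    rw [← hη, Marker.level, Marker.take, List.length_take]
    exact (min_eq_left hj).symm
  subst hjN
  have hsub : Finset.range ((η'.take j).level + 1) ⊆ Finset.range (η'.level + 1) :=
    Finset.range_subset_range.2 (by omega)
  rw [cumul, cumul, ← Finset.sum_subset hsub]
  · refine Finset.sum_congr rfl fun i hi => ?_
    have hij : i ≤ j := by
      rw [hη] at hi
      exact Nat.lt_succ_iff.1 (Finset.mem_range.1 hi)
    simp [Marker.take, List.take_take, min_eq_left hij]
  · intro i hi hi'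
    refine hN _ ?_
    have h1 := Finset.mem_range.1 hi
    have h2 : ¬ i < (η'.take j).level + 1 := fun h => hi' (Finset.mem_range.2 h)
    have h3 : (η'.take i).level = i := by
      simp only [Marker.level, Marker.take, List.length_take]
      exact min_eq_left (Nat.lt_succ_iff.1 h1)
    omega

theorem greenPartial_le_smul {A : Op X} {w : X → ℝ≥0∞} {C : ℝ≥0∞} (h : act A w ≤ C • w) (n : ℕ) :
    greenPartial A w n ≤ (∑ k ∈ Finset.range n, C ^ k) • w := by
  rw [greenPartial, Finset.sum_smul]
  refine Finset.sum_le_sum fun k hk => ?_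
  clear hk
  induction k with
  | zero => rw [pow_zero, pow_zero, act_one, one_smul]
  | succ k ih =>
    rw [pow_succ', act_mul]
    refine (act_mono A ih).trans ?_
    rw [act_smul, pow_succ, mul_smul]
    exact fun x => mul_le_mul_right (h x) _

theorem CondD'.condA {Λ : Set X} {c w : X → ℝ≥0} {α : X → X → ℝ≥0}
    (hbdd : BoundedOn Λ w α) (h : CondD' Λ c w α) : CondA Λ c w α := by
  obtain ⟨ν, hS, hΛ, ⟨N, hN⟩, hsum⟩ := h
  obtain ⟨C, hC⟩ := hbdd
  set W : X → ℝ≥0∞ := fun y => (w y : ℝ≥0∞) with hW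
  set A := proj Λ * toOp α * proj Λ with hA
  have hAW : act A W ≤ (C : ℝ≥0∞) • W := hC
  set D : ℕ → ℝ≥0∞ := fun n => ∑ k ∈ Finset.range n, (C : ℝ≥0∞) ^ k with hD
  have hDtop : ∀ n, D n ≠ ∞ := fun n =>
    ENNReal.sum_ne_top.2 fun k _ => ENNReal.pow_ne_top ENNReal.coe_ne_top
  have hD1 : 1 ≤ D (N + 1) := by
    simp only [hD]
    rw [Finset.sum_range_succ', pow_zero]
    exact le_add_self
  have hD0 : D (N + 1) ≠ 0 := (one_pos.trans_le hD1).ne'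
  have main : green A W ≤ D (N + 1) • green (proj Λ * cloudOp α ν * proj Λ) W := by
    refine green_le_of_greenPartial_le fun n => ?_
    set s := greenPartial A W n with hs
    have hsub : s ≤ W + act A s := by
      rw [hs, ← greenPartial_succ]
      exact greenPartial_le_succ A W n
    refine le_smul_green (hDtop n) hD0 (greenPartial_le_smul hAW n) fun x => ?_
    rw [Pi.add_apply, act_compress]
    by_cases hx : x ∈ Λ
    · rw [Set.indicator_of_mem hx, act_cloudOp_indicator hΛ _ hx, ← hA]
      have h1 := le_pathSum hsub N (cloudFun ν) x 1 fun t ht => by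
        rw [cum_cloudFun hS.1]
        exact one_le_cumul_of_level_eq hS hN _ ht
      rw [one_mul, one_mul] at h1
      refine h1.trans (add_le_add_left ?_ _)
      exact ((greenPartial_le_succ A W N).trans (greenPartial_le_smul hAW (N + 1))) x
    · have h1 := hsub x
      rw [Pi.add_apply, hA, act_compress] at h1
      simp only [Set.indicator_of_notMem hx, add_zero] at h1 ⊢
      exact h1.trans (le_mul_of_one_le_left zero_le hD1)
  have hinv : (D (N + 1))⁻¹ ≠ 0 := ENNReal.inv_ne_zero.2 (hDtop _)
  refine geomSum_lt_top_of_smul_green_le hinv hsum fun x => ?_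
  calc (D (N + 1))⁻¹ * green A W x
      ≤ (D (N + 1))⁻¹ * (D (N + 1) * green (proj Λ * cloudOp α ν * proj Λ) W x) :=
        mul_le_mul_right (main x) _
    _ = green (proj Λ * cloudOp α ν * proj Λ) W x := by
        rw [← mul_assoc, ENNReal.inv_mul_cancel hD0 (hDtop _), one_mul]

end

end Balayage

theorem theorem6p1 {X : Type*} [Countable X] (Λ : Set X) (c w : X → ℝ≥0)
    (hc : ∀ x ∈ Λ, 0 < c x) (hw : ∀ x ∈ Λ, 0 < w x) (α : X → X → ℝ≥0) :
    List.TFAE [Balayage.CondA Λ c w α, Balayage.CondB Λ c w α, Balayage.CondB' Λ c w α,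
      Balayage.CondC Λ c w α, Balayage.CondD Λ c w α] ∧
    (Balayage.CondD Λ c w α → Balayage.CondC' Λ c w α) ∧
    (Balayage.CondC' Λ c w α → Balayage.CondD' Λ c w α) ∧
    (Balayage.BoundedOn Λ w α →
      List.TFAE [Balayage.CondA Λ c w α, Balayage.CondB Λ c w α, Balayage.CondB' Λ c w α,
        Balayage.CondC Λ c w α, Balayage.CondC' Λ c w α, Balayage.CondD Λ c w α,
        Balayage.CondD' Λ c w α]) := by
  open Balayage in
  have ac : CondA Λ c w α → CondC Λ c w α := CondA.condC
  have cb : CondC Λ c w α → CondB Λ c w α := CondC.condB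
  have bb' : CondB Λ c w α → CondB' Λ c w α := CondB.condB'
  have b'a : CondB' Λ c w α → CondA Λ c w α := CondB'.condA hc
  have ad : CondA Λ c w α → CondD Λ c w α := CondA.condD
  have da : CondD Λ c w α → CondA Λ c w α := CondD.condA
  have b'c' : CondB' Λ c w α → CondC' Λ c w α := CondB'.condC'
  have c'd' : CondC' Λ c w α → CondD' Λ c w α := CondC'.condD'
  refine ⟨?_, fun hd => b'c' (bb' (cb (ac (da hd)))), c'd', fun hbdd => ?_⟩
  · tfae_have 1 → 4 := ac
    tfae_have 4 → 2 := cb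
    tfae_have 2 → 3 := bb'
    tfae_have 3 → 1 := b'a
    tfae_have 1 → 5 := ad
    tfae_have 5 → 1 := da
    tfae_finish
  · have d'a : CondD' Λ c w α → CondA Λ c w α := CondD'.condA hbdd
    tfae_have 1 → 4 := ac
    tfae_have 4 → 2 := cb
    tfae_have 2 → 3 := bb'
    tfae_have 3 → 1 := b'a
    tfae_have 1 → 6 := ad
    tfae_have 6 → 1 := da
    tfae_have 3 → 5 := b'c'
    tfae_have 5 → 7 := c'd'
    tfae_have 7 → 1 := d'a
    tfae_finish
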